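/- Let $\sigma>0$, let $g$ be the density of $N(0,\sigma^2)$, and let $\varphi:\mathbb R\to\mathbb R$ be measurable with $\int|\varphi(x)|\,g(x)\,dx<\infty$ and not equal Lebesgue-almost everywhere to a constant. For $\mu\in(0,1]$ and a probability density $f_0$ on $\mathbb R$ let $Y_1,\dots,Y_n$ be i.i.d. copies of $Y=\theta+\xi$, where $\theta$ and $\xi$ are independent, $\xi\sim N(0,\sigma^2)$, and $\theta$ has the sparse mixing distribution $\mu f_0(x)\,dx+(1-\mu)\delta_0(dx)$. Let $\mathbb E_{f_0}$ denote the expectation over $(Y_1,\dots,Y_n)$ and put $\Phi(f_0)=\int\varphi(\theta)f_0(\theta)\,d\theta$. For $C_I>0$ let $\mathcal P(C_I)$ be the set of all pairs $(f_1,f_2)$ of probability densities on $\mathbb R$ with $\int|\varphi|f_k<\infty$, $$I_k=\int g^{-1}(x)\Bigl[\int g(x-\theta)f_k(\theta)\,d\theta\Bigr]^2dx\le C_I\quad(k=1,2),\qquad \int\varphi(\theta)\,[f_1(\theta)-f_2(\theta)]\,d\theta\ne0 .$$ Then there are constants $C_I>0$ and $C>0$, depending only on $\sigma$ and $\varphi$,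 such that $\mathcal P(C_I)\neq\emptyset$ and, for every $n\ge1$ and every $\mu=\mu_n\in(0,1]$, $$\inf_{\widetilde\Phi}\ \sup_{(f_1,f_2)\in\mathcal P(C_I)}\ \max_{k=1,2}\ \mathbb E_{f_k}\bigl(\widetilde\Phi(Y_1,\dots,Y_n)-\Phi(f_k)\bigr)^2\ \ge\ C\min\bigl(1,(n\mu_n^2)^{-1}\bigr),$$ where the infimum is over all estimators, i.e. all measurable functions $\widetilde\Phi:\mathbb R^n\to\mathbb R$ (which may depend on $n$, $\mu_n$, $\sigma$, $\varphi$). -/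

import Mathlib

open MeasureTheory ProbabilityTheory Set
open scoped NNReal ENNReal

namespace SparseDeconv

noncomputable section

/-- `f` is a probability density function on the real line. -/
structure IsPDF (f : ℝ → ℝ) : Prop where
  measurable : Measurable f
  nonneg : ∀ x, 0 ≤ f x
  lintegral_eq_one : ∫⁻ x, ENNReal.ofReal (f x) = 1

/-- The law of the sparse mixing variable `θ`, with "density" `μ f₀ + (1 - μ) δ`. -/
def mixingLaw (μ : ℝ) (f₀ : ℝ → ℝ) : Measure ℝ :=
  ENNReal.ofReal μ • volume.withDensity (fun θ => ENNReal.ofReal (f₀ θ)) +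
    ENNReal.ofReal (1 - μ) • Measure.dirac 0

/-- The law of one observation `Y = θ + ξ`, where `θ` has the sparse mixing law and `ξ` is an
independent error with density `g`. -/
def observationLaw (g : ℝ → ℝ) (μ : ℝ) (f₀ : ℝ → ℝ) : Measure ℝ :=
  Measure.conv (mixingLaw μ f₀) (volume.withDensity (fun x => ENNReal.ofReal (g x)))

/-- The law of the sample `(Y₁, …, Yₙ)` of independent observations. -/
def sampleLaw (g : ℝ → ℝ) (n : ℕ) (μ : ℝ) (f₀ : ℝ → ℝ) : Measure (Fin n → ℝ) :=
  Measure.pi (fun _ => observationLaw g μ f₀)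

/-- The functional `Φ_μ = ∫ φ f₀` of the density `f₀` of the nonzero entries. -/
def functional (φ f₀ : ℝ → ℝ) : ℝ := ∫ θ, φ θ * f₀ θ

/-- The mean squared risk `E (T(Y₁, …, Yₙ) - Φ_μ)²` of the estimator `T` under `f₀`. -/
def risk (g φ : ℝ → ℝ) {n : ℕ} (μ : ℝ) (T : (Fin n → ℝ) → ℝ) (f₀ : ℝ → ℝ) : ℝ≥0∞ :=
  ∫⁻ y, ENNReal.ofReal ((T y - functional φ f₀) ^ 2) ∂(sampleLaw g n μ f₀)

/-- The integral `I = ∫ g⁻¹(x) [∫ g(x - θ) f(θ) dθ]² dx`. -/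
def chiIntegral (g f : ℝ → ℝ) : ℝ≥0∞ :=
  ∫⁻ x, (ENNReal.ofReal (g x))⁻¹ *
    (∫⁻ θ, ENNReal.ofReal (g (x - θ)) * ENNReal.ofReal (f θ)) ^ 2

/-- The pairs of densities `(f₁, f₂)`, with well-defined functionals, such that `I₁ ≤ C_I`,
`I₂ ≤ C_I` and `∫ φ (f₁ - f₂) ≠ 0`. -/
structure IsAdmissiblePair (g φ : ℝ → ℝ) (C_I : ℝ) (f₁ f₂ : ℝ → ℝ) : Prop where
  pdf₁ : IsPDF f₁
  pdf₂ : IsPDF f₂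
  integrable₁ : Integrable (fun θ => φ θ * f₁ θ)
  integrable₂ : Integrable (fun θ => φ θ * f₂ θ)
  chi₁ : chiIntegral g f₁ ≤ ENNReal.ofReal C_I
  chi₂ : chiIntegral g f₂ ≤ ENNReal.ofReal C_I
  separated : ∫ θ, φ θ * (f₁ θ - f₂ θ) ≠ 0

/-- The minimax risk: the infimum over all estimators `T` (measurable functions of the `n`
observations) of the supremum over all admissible pairs `(f₁, f₂)` of the larger of the two
risks of `T` under `f₁` and under `f₂`. -/
def minimaxRisk (g φ : ℝ → ℝ) (C_I : ℝ) (n : ℕ) (μ : ℝ) : ℝ≥0∞ :=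
  ⨅ (T : (Fin n → ℝ) → ℝ) (_ : Measurable T),
    ⨆ (f₁ : ℝ → ℝ) (f₂ : ℝ → ℝ) (_ : IsAdmissiblePair g φ C_I f₁ f₂),
      max (risk g φ μ T f₁) (risk g φ μ T f₂)

end

end SparseDeconv

/-!
Starting from an admissible pair `(f₁, f₂)`, the two-point method is applied to the midpoint `f₀` of
the pair and to `f₀ + ε (f₂ - f₁) / 2`. Since `|f₂ - f₁| / 2 ≤ f₀`, the density of one observation
changes by at most `μ ε s`, where `s = g * f₀`, and its base value is `μ s + (1 - μ) g`. A convex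
combination is at least the minimum of its terms, so `s² / (μ s + (1 - μ) g) ≤ s + s² / g`, and
the second moment of the likelihood ratio is at most `1 + (μ ε)² (1 + C_I)`. For `n` observations
and `ε² = min 1 (n μ²)⁻¹` it stays below `exp (1 + C_I)`, while the two functionals differ by a
multiple of `ε`.

An admissible pair is made of uniform densities on compact sets: since `φ` is not almost everywhere
constant, its averages over compact sets are not all equal.
-/

namespace SparseDeconv

section TwoPointBound

variable {Ω : Type*} [MeasurableSpace Ω]

lemma sq_lintegral_mul_le (P : Measure Ω) {u w : Ω → ℝ≥0∞} (hu : AEMeasurable u P)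
    (hw : AEMeasurable w P) :
    (∫⁻ x, u x * w x ∂P) ^ 2 ≤ (∫⁻ x, u x ^ 2 ∂P) * ∫⁻ x, w x ^ 2 ∂P := by
  have holder := pow_le_pow_left'
    (ENNReal.lintegral_mul_le_Lp_mul_Lq P Real.HolderConjugate.two_two hu hw) 2
  simp only [Pi.mul_apply, ENNReal.rpow_two, mul_pow] at holder
  simpa only [← ENNReal.rpow_natCast, ← ENNReal.rpow_mul, Nat.cast_ofNat, one_div, ne_eq,
    OfNat.ofNat_ne_zero, not_false_eq_true, inv_mul_cancel₀, ENNReal.rpow_one] using holder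

lemma sq_lintegral_le (P : Measure Ω) [IsProbabilityMeasure P] {u : Ω → ℝ≥0∞}
    (hu : AEMeasurable u P) : (∫⁻ x, u x ∂P) ^ 2 ≤ ∫⁻ x, u x ^ 2 ∂P := by
  simpa using sq_lintegral_mul_le P hu (aemeasurable_const (b := (1 : ℝ≥0∞)))

lemma sq_lintegral_withDensity_le (P : Measure Ω) {ℓ u : Ω → ℝ≥0∞} (hℓ : Measurable ℓ)
    (hu : Measurable u) :
    (∫⁻ x, u x ∂(P.withDensity ℓ)) ^ 2 ≤ (∫⁻ x, ℓ x ^ 2 ∂P) * ∫⁻ x, u x ^ 2 ∂P := by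
  rw [lintegral_withDensity_eq_lintegral_mul _ hℓ hu]
  exact sq_lintegral_mul_le P hℓ.aemeasurable hu.aemeasurable

lemma add_sq_le_two_mul (x y : ℝ≥0∞) : (x + y) ^ 2 ≤ 2 * (x ^ 2 + y ^ 2) := by
  have h := ENNReal.rpow_add_le_mul_rpow_add_rpow x y one_le_two
  norm_num at h
  exact h

-- Le Cam's method: `edist a b ≤ edist (T x) a + edist (T x) b` is integrated under the second law,
-- and the first summand is transported to `P` by the Cauchy-Schwarz inequality.
lemma sq_edist_le_max_lintegral_withDensity {E : Type*} [PseudoEMetricSpace E] [MeasurableSpace E]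
    [OpensMeasurableSpace E] (P : Measure Ω) {ℓ : Ω → ℝ≥0∞} (hℓ : Measurable ℓ)
    [IsProbabilityMeasure (P.withDensity ℓ)] {T : Ω → E} (hT : Measurable T) (a b : E) :
    edist a b ^ 2 ≤ 2 * (∫⁻ x, ℓ x ^ 2 ∂P + 1) *
      max (∫⁻ x, edist (T x) a ^ 2 ∂P) (∫⁻ x, edist (T x) b ^ 2 ∂(P.withDensity ℓ)) := by
  have ha : Measurable fun x => edist (T x) a := measurable_edist_left.comp hT
  have hb : Measurable fun x => edist (T x) b := measurable_edist_left.comp hT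
  set Q := P.withDensity ℓ
  set S := ∫⁻ x, ℓ x ^ 2 ∂P
  set R := max (∫⁻ x, edist (T x) a ^ 2 ∂P) (∫⁻ x, edist (T x) b ^ 2 ∂Q)
  have triangle : edist a b ≤ ∫⁻ x, edist (T x) a ∂Q + ∫⁻ x, edist (T x) b ∂Q :=
    calc edist a b = ∫⁻ _, edist a b ∂Q := by simp
      _ ≤ ∫⁻ x, (edist (T x) a + edist (T x) b) ∂Q :=
        lintegral_mono fun x => edist_triangle_left a b (T x)
      _ = _ := lintegral_add_left ha _
  calc edist a b ^ 2 ≤ (∫⁻ x, edist (T x) a ∂Q + ∫⁻ x, edist (T x) b ∂Q) ^ 2 := by gcongr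
    _ ≤ 2 * ((∫⁻ x, edist (T x) a ∂Q) ^ 2 + (∫⁻ x, edist (T x) b ∂Q) ^ 2) :=
        add_sq_le_two_mul _ _
    _ ≤ 2 * (S * R + R) := by
        gcongr
        · exact (sq_lintegral_withDensity_le P hℓ ha).trans (by gcongr; exact le_max_left _ _)
        · exact (sq_lintegral_le Q hb.aemeasurable).trans (le_max_right _ _)
    _ = 2 * (S + 1) * R := by ring

end TwoPointBound

section Product

variable {ι : Type*} [Fintype ι] {α : ι → Type*}

lemma indicator_univ_pi_prod (s : ∀ i, Set (α i)) (u : ∀ i, α i → ℝ≥0∞) (y : ∀ i, α i) :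
    (univ.pi s).indicator (fun y => ∏ i, u i (y i)) y = ∏ i, (s i).indicator (u i) (y i) := by
  by_cases hy : y ∈ univ.pi s
  · rw [indicator_of_mem hy]
    exact Finset.prod_congr rfl fun i _ => (indicator_of_mem (hy i (mem_univ i)) _).symm
  · rw [indicator_of_notMem hy]
    obtain ⟨i, hi⟩ : ∃ i, y i ∉ s i := by simpa using hy
    exact (Finset.prod_eq_zero (Finset.mem_univ i) (indicator_of_notMem hi _)).symm

variable [∀ i, MeasurableSpace (α i)]

lemma lintegral_pi_prod (P : ∀ i, Measure (α i)) [∀ i, IsProbabilityMeasure (P i)]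
    {u : ∀ i, α i → ℝ≥0∞} (hu : ∀ i, Measurable (u i)) :
    ∫⁻ y, ∏ i, u i (y i) ∂(Measure.pi P) = ∏ i, ∫⁻ x, u i x ∂(P i) := by
  have hindep : iIndepFun (fun i (y : ∀ i, α i) => u i (y i)) (Measure.pi P) :=
    iIndepFun_pi fun i => (hu i).aemeasurable
  rw [lintegral_prod_eq_prod_lintegral_of_indepFun Finset.univ _ hindep
    fun i => (hu i).comp (measurable_pi_apply i)]
  exact Finset.prod_congr rfl fun i _ => (measurePreserving_eval P i).lintegral_comp (hu i)

lemma pi_withDensity (P : ∀ i, Measure (α i)) [∀ i, IsProbabilityMeasure (P i)]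
    {ℓ : ∀ i, α i → ℝ≥0∞} (hℓ : ∀ i, Measurable (ℓ i))
    [∀ i, SigmaFinite ((P i).withDensity (ℓ i))] :
    Measure.pi (fun i => (P i).withDensity (ℓ i)) =
      (Measure.pi P).withDensity fun y => ∏ i, ℓ i (y i) := by
  refine Measure.pi_eq fun s hs => ?_
  rw [withDensity_apply _ (.univ_pi hs), ← lintegral_indicator (.univ_pi hs)]
  simp_rw [indicator_univ_pi_prod]
  rw [lintegral_pi_prod P fun i => (hℓ i).indicator (hs i)]
  refine Finset.prod_congr rfl fun i _ => ?_
  rw [lintegral_indicator (hs i), withDensity_apply _ (hs i)]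

end Product

lemma sq_edist_le_max_lintegral_pi {ι Ω E : Type*} [Fintype ι] [MeasurableSpace Ω]
    [PseudoEMetricSpace E] [MeasurableSpace E] [OpensMeasurableSpace E] (P : Measure Ω)
    [IsProbabilityMeasure P] {ℓ : Ω → ℝ≥0∞} (hℓ : Measurable ℓ)
    [IsProbabilityMeasure (P.withDensity ℓ)] {T : (ι → Ω) → E} (hT : Measurable T) (a b : E) :
    edist a b ^ 2 ≤ 2 * ((∫⁻ x, ℓ x ^ 2 ∂P) ^ Fintype.card ι + 1) *
      max (∫⁻ y, edist (T y) a ^ 2 ∂(Measure.pi fun _ => P))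
        (∫⁻ y, edist (T y) b ^ 2 ∂(Measure.pi fun _ => P.withDensity ℓ)) := by
  have hpi := pi_withDensity (fun _ : ι => P) fun _ => hℓ
  have : IsProbabilityMeasure ((Measure.pi fun _ : ι => P).withDensity fun y => ∏ i, ℓ (y i)) := by
    rw [← hpi]; infer_instance
  have hsq : ∫⁻ y, (∏ i, ℓ (y i)) ^ 2 ∂(Measure.pi fun _ : ι => P) =
      (∫⁻ x, ℓ x ^ 2 ∂P) ^ Fintype.card ι := by
    simp_rw [← Finset.prod_pow]
    rw [lintegral_pi_prod (fun _ : ι => P) fun _ => hℓ.pow_const 2, Finset.prod_const,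
      Finset.card_univ]
  rw [hpi, ← hsq]
  exact sq_edist_le_max_lintegral_withDensity _ (by fun_prop) hT a b

section ChiSquare

lemma sq_div_mul_add_le {p q d : ℝ≥0∞} (hp : p ≠ ∞) (hqp : q ≤ p + d) (hpq : p ≤ q + d) :
    (q / p) ^ 2 * p + p ≤ 2 * q + d ^ 2 / p := by
  rcases eq_or_ne p 0 with rfl | hp0
  · simp
  rcases eq_or_ne d ∞ with rfl | hd
  · simp [ENNReal.top_div_of_ne_top hp]
  have hq : q ≠ ∞ := ne_top_of_le_ne_top (ENNReal.add_ne_top.2 ⟨hp, hd⟩) hqp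
  lift p to ℝ≥0 using hp
  lift q to ℝ≥0 using hq
  lift d to ℝ≥0 using hd
  have hp0 : p ≠ 0 := by exact_mod_cast hp0
  rw [← ENNReal.coe_div hp0, ← ENNReal.coe_pow d, ← ENNReal.coe_div hp0]
  norm_cast at hqp hpq ⊢
  rw [← NNReal.coe_le_coe] at hqp hpq ⊢
  push_cast at hqp hpq ⊢
  have hdiff : ((q : ℝ) - p) ^ 2 ≤ (d : ℝ) ^ 2 := sq_le_sq' (by linarith) (by linarith)
  calc ((q : ℝ) / p) ^ 2 * p + p = 2 * q + (q - p) ^ 2 / p := by field_simp; ring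
    _ ≤ 2 * q + (d : ℝ) ^ 2 / p := by gcongr

lemma lintegral_sq_div_mul_le {Ω : Type*} [MeasurableSpace Ω] {ν : Measure Ω}
    {p q d : Ω → ℝ≥0∞} (hpm : Measurable p) (hqm : Measurable q) (hp : ∫⁻ x, p x ∂ν = 1)
    (hq : ∫⁻ x, q x ∂ν = 1) (hqp : ∀ x, q x ≤ p x + d x) (hpq : ∀ x, p x ≤ q x + d x) :
    ∫⁻ x, (q x / p x) ^ 2 * p x ∂ν ≤ 1 + ∫⁻ x, d x ^ 2 / p x ∂ν := by
  have hfin : ∀ᵐ x ∂ν, p x < ∞ := ae_lt_top hpm (by simp [hp])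
  have hsum : ∫⁻ x, (q x / p x) ^ 2 * p x ∂ν + 1 ≤ 1 + ∫⁻ x, d x ^ 2 / p x ∂ν + 1 :=
    calc ∫⁻ x, (q x / p x) ^ 2 * p x ∂ν + 1
        = ∫⁻ x, ((q x / p x) ^ 2 * p x + p x) ∂ν := by rw [lintegral_add_right _ hpm, hp]
      _ ≤ ∫⁻ x, (2 * q x + d x ^ 2 / p x) ∂ν := by
        refine lintegral_mono_ae ?_
        filter_upwards [hfin] with x hx
        exact sq_div_mul_add_le hx.ne (hqp x) (hpq x)
      _ = 1 + ∫⁻ x, d x ^ 2 / p x ∂ν + 1 := by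
        rw [lintegral_add_left (by fun_prop), lintegral_const_mul _ hqm, hq]
        ring
  exact (ENNReal.add_le_add_iff_right ENNReal.one_ne_top).1 hsum

-- A convex combination dominates the smaller of its two terms.
lemma sq_div_convexCombination_le {s t a b : ℝ≥0∞} (hab : a + b = 1) :
    s ^ 2 / (a * s + b * t) ≤ s + t⁻¹ * s ^ 2 := by
  have hmin : min s t ≤ a * s + b * t :=
    calc min s t = a * min s t + b * min s t := by rw [← add_mul, hab, one_mul]
      _ ≤ a * s + b * t := by gcongr; exacts [min_le_left _ _, min_le_right _ _]
  refine (ENNReal.div_le_div_left hmin _).trans ?_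
  rcases le_total s t with h | h
  · rw [min_eq_left h, sq, mul_div_assoc]
    exact (mul_le_of_le_one_right' ENNReal.div_self_le_one).trans le_self_add
  · rw [min_eq_right h, ENNReal.div_eq_inv_mul]
    exact le_add_self

end ChiSquare

section ObservationLaw

/-- The convolution of the error density `g` with the density `f`. It takes values in `ℝ≥0∞`, so
that it is meaningful without any integrability. -/
noncomputable def convDensity (g f : ℝ → ℝ) (x : ℝ) : ℝ≥0∞ :=
  ∫⁻ θ, ENNReal.ofReal (g (x - θ)) * ENNReal.ofReal (f θ)

/-- The Lebesgue density of `observationLaw g μ f`. -/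
noncomputable def observationDensity (g : ℝ → ℝ) (μ : ℝ) (f : ℝ → ℝ) (x : ℝ) : ℝ≥0∞ :=
  ENNReal.ofReal μ * convDensity g f x + ENNReal.ofReal (1 - μ) * ENNReal.ofReal (g x)

/-- The density of `observationLaw g μ f` with respect to `observationLaw g μ f₀`, with the
convention `0 / 0 = 0`. -/
noncomputable def likelihoodRatio (g : ℝ → ℝ) (μ : ℝ) (f₀ f : ℝ → ℝ) (x : ℝ) : ℝ≥0∞ :=
  observationDensity g μ f x / observationDensity g μ f₀ x

variable {g f f₀ : ℝ → ℝ} {μ ε : ℝ}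

@[fun_prop]
lemma measurable_convDensity (hg : Measurable g) (hf : Measurable f) :
    Measurable (convDensity g f) := by
  have : Measurable (Function.uncurry fun x θ : ℝ =>
      ENNReal.ofReal (g (x - θ)) * ENNReal.ofReal (f θ)) := by
    unfold Function.uncurry; fun_prop
  exact this.lintegral_prod_right

@[fun_prop]
lemma measurable_observationDensity (hg : Measurable g) (hf : Measurable f) (μ : ℝ) :
    Measurable (observationDensity g μ f) := by
  unfold observationDensity; fun_prop

@[fun_prop]
lemma measurable_likelihoodRatio (hg : Measurable g) (hf₀ : Measurable f₀) (hf : Measurable f)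
    (μ : ℝ) : Measurable (likelihoodRatio g μ f₀ f) := by
  unfold likelihoodRatio; fun_prop

lemma IsPDF.isProbabilityMeasure (hf : IsPDF f) :
    IsProbabilityMeasure (volume.withDensity fun θ => ENNReal.ofReal (f θ)) :=
  ⟨by rw [withDensity_apply _ .univ, setLIntegral_univ, hf.lintegral_eq_one]⟩

lemma ofReal_add_ofReal_eq_one {a b : ℝ} (ha : 0 ≤ a) (hb : 0 ≤ b) (hab : a + b = 1) :
    ENNReal.ofReal a + ENNReal.ofReal b = 1 := by
  rw [← ENNReal.ofReal_add ha hb, hab, ENNReal.ofReal_one]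

lemma isProbabilityMeasure_mixingLaw (hf : IsPDF f) (hμ : μ ∈ Icc 0 1) :
    IsProbabilityMeasure (mixingLaw μ f) where
  measure_univ := by
    have := hf.isProbabilityMeasure
    simpa [mixingLaw] using ofReal_add_ofReal_eq_one hμ.1 (sub_nonneg.2 hμ.2) (add_sub_cancel μ 1)

lemma isProbabilityMeasure_observationLaw (hg : IsPDF g) (hf : IsPDF f) (hμ : μ ∈ Icc 0 1) :
    IsProbabilityMeasure (observationLaw g μ f) := by
  have := hg.isProbabilityMeasure
  have := isProbabilityMeasure_mixingLaw hf hμ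
  unfold observationLaw
  infer_instance

lemma lconvolution_eq_convDensity (g f : ℝ → ℝ) :
    (fun θ => ENNReal.ofReal (f θ)) ⋆ₗ[volume] (fun x => ENNReal.ofReal (g x)) =
      convDensity g f := by
  funext x
  rw [lconvolution_def, convDensity]
  exact lintegral_congr fun θ => by rw [mul_comm, sub_eq_neg_add]

lemma observationLaw_eq_withDensity (hg : IsPDF g) (hf : IsPDF f) (μ : ℝ) :
    observationLaw g μ f = volume.withDensity (observationDensity g μ f) := by
  have := hg.isProbabilityMeasure
  have := hf.isProbabilityMeasure
  have hgm := hg.measurable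
  have hfm := hf.measurable
  have hm : Measurable (convDensity g f) := measurable_convDensity hgm hfm
  unfold observationLaw mixingLaw
  rw [Measure.add_conv, Measure.conv_smul_left, Measure.conv_smul_left, Measure.dirac_zero_conv,
    conv_withDensity_eq_lconvolution (by fun_prop) (by fun_prop), lconvolution_eq_convDensity,
    ← withDensity_smul _ hm, ← withDensity_smul _ (by fun_prop),
    ← withDensity_add_left (hm.const_smul _)]
  rfl

lemma lintegral_observationDensity (hg : IsPDF g) (hf : IsPDF f) (hμ : μ ∈ Icc 0 1) :
    ∫⁻ x, observationDensity g μ f x = 1 := by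
  have := isProbabilityMeasure_observationLaw hg hf hμ
  rw [← setLIntegral_univ, ← withDensity_apply _ .univ, ← observationLaw_eq_withDensity hg hf,
    measure_univ]

lemma convDensity_le_add {f₁ f₂ : ℝ → ℝ} (hg : Measurable g) (h₁ : Measurable f₁)
    (h₂ : Measurable f₂) (hε : 0 ≤ ε) (h : ∀ θ, f θ ≤ f₁ θ + ε * f₂ θ) (x : ℝ) :
    convDensity g f x ≤ convDensity g f₁ x + ENNReal.ofReal ε * convDensity g f₂ x := by
  unfold convDensity
  rw [← lintegral_const_mul _ (by fun_prop), ← lintegral_add_left (by fun_prop)]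
  refine lintegral_mono fun θ => ?_
  calc ENNReal.ofReal (g (x - θ)) * ENNReal.ofReal (f θ)
      ≤ ENNReal.ofReal (g (x - θ)) * (ENNReal.ofReal (f₁ θ) + ENNReal.ofReal (ε * f₂ θ)) := by
        gcongr
        exact (ENNReal.ofReal_le_ofReal (h θ)).trans ENNReal.ofReal_add_le
    _ = _ := by rw [ENNReal.ofReal_mul hε]; ring

lemma observationDensity_le_add {f₁ f₂ : ℝ → ℝ} (hg : Measurable g) (h₁ : Measurable f₁)
    (h₂ : Measurable f₂) (hμ : 0 ≤ μ) (hε : 0 ≤ ε) (h : ∀ θ, f θ ≤ f₁ θ + ε * f₂ θ) (x : ℝ) :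
    observationDensity g μ f x ≤
      observationDensity g μ f₁ x + ENNReal.ofReal (μ * ε) * convDensity g f₂ x :=
  calc observationDensity g μ f x
      ≤ ENNReal.ofReal μ * (convDensity g f₁ x + ENNReal.ofReal ε * convDensity g f₂ x) +
          ENNReal.ofReal (1 - μ) * ENNReal.ofReal (g x) := by
        unfold observationDensity
        gcongr
        exact convDensity_le_add hg h₁ h₂ hε h x
    _ = _ := by rw [observationDensity, ENNReal.ofReal_mul hμ]; ring

lemma observationDensity_eq_zero_of_abs_sub_le (hg : Measurable g) (hf₀ : Measurable f₀)
    (hμ : 0 ≤ μ) (hε : 0 ≤ ε) (h : ∀ θ, |f θ - f₀ θ| ≤ ε * f₀ θ) {x : ℝ}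
    (hx : observationDensity g μ f₀ x = 0) : observationDensity g μ f x = 0 := by
  have hle := observationDensity_le_add hg hf₀ hf₀ hμ hε
    (fun θ => sub_le_iff_le_add'.1 (abs_sub_le_iff.1 (h θ)).1) x
  have hzero : ENNReal.ofReal μ * convDensity g f₀ x = 0 := (add_eq_zero.1 hx).1
  rwa [hx, ENNReal.ofReal_mul hμ, mul_right_comm, hzero, zero_mul, add_zero, nonpos_iff_eq_zero]
    at hle

lemma observationLaw_eq_withDensity_likelihoodRatio (hg : IsPDF g) (hf₀ : IsPDF f₀)
    (hf : IsPDF f) (hμ : μ ∈ Icc 0 1) (hε : 0 ≤ ε) (h : ∀ θ, |f θ - f₀ θ| ≤ ε * f₀ θ) :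
    observationLaw g μ f = (observationLaw g μ f₀).withDensity (likelihoodRatio g μ f₀ f) := by
  have hgm := hg.measurable
  have hf₀m := hf₀.measurable
  have hfm := hf.measurable
  have hfin : ∀ᵐ x, observationDensity g μ f₀ x < ∞ :=
    ae_lt_top (by fun_prop) (by simp [lintegral_observationDensity hg hf₀ hμ])
  rw [observationLaw_eq_withDensity hg hf, observationLaw_eq_withDensity hg hf₀,
    ← withDensity_mul _ (by fun_prop) (by fun_prop)]
  refine withDensity_congr_ae ?_
  filter_upwards [hfin] with x hx
  exact (ENNReal.mul_div_cancel' (observationDensity_eq_zero_of_abs_sub_le hgm hf₀m hμ.1 hε h)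
    fun htop => absurd htop hx.ne).symm

lemma lintegral_convDensity (hg : IsPDF g) (hf : IsPDF f) : ∫⁻ x, convDensity g f x = 1 := by
  simpa [observationDensity] using lintegral_observationDensity hg hf (right_mem_Icc.2 zero_le_one)

lemma lintegral_convDensity_sq_div_le (hg : IsPDF g) (hf : IsPDF f) (hμ : μ ∈ Icc 0 1) :
    ∫⁻ x, convDensity g f x ^ 2 / observationDensity g μ f x ≤ 1 + chiIntegral g f := by
  calc ∫⁻ x, convDensity g f x ^ 2 / observationDensity g μ f x
      ≤ ∫⁻ x, (convDensity g f x + (ENNReal.ofReal (g x))⁻¹ * convDensity g f x ^ 2) :=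
        lintegral_mono fun _ => sq_div_convexCombination_le
          (ofReal_add_ofReal_eq_one hμ.1 (sub_nonneg.2 hμ.2) (add_sub_cancel μ 1))
    _ = 1 + chiIntegral g f := by
        rw [lintegral_add_left (measurable_convDensity hg.measurable hf.measurable),
          lintegral_convDensity hg hf]
        rfl

-- The perturbation moves the density of one observation by at most `μ ε` times `convDensity g f₀`,
-- which is where the square of `μ` comes from.
lemma lintegral_likelihoodRatio_sq_le (hg : IsPDF g) (hf₀ : IsPDF f₀) (hf : IsPDF f)
    (hμ : μ ∈ Icc 0 1) (hε : 0 ≤ ε) (h : ∀ θ, |f θ - f₀ θ| ≤ ε * f₀ θ) :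
    ∫⁻ x, likelihoodRatio g μ f₀ f x ^ 2 ∂(observationLaw g μ f₀) ≤
      1 + ENNReal.ofReal ((μ * ε) ^ 2) * (1 + chiIntegral g f₀) := by
  have hgm := hg.measurable
  have hf₀m := hf₀.measurable
  have hfm := hf.measurable
  set d : ℝ → ℝ≥0∞ := fun x => ENNReal.ofReal (μ * ε) * convDensity g f₀ x
  calc ∫⁻ x, likelihoodRatio g μ f₀ f x ^ 2 ∂(observationLaw g μ f₀)
      = ∫⁻ x, (observationDensity g μ f x / observationDensity g μ f₀ x) ^ 2 *
          observationDensity g μ f₀ x := by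
        rw [observationLaw_eq_withDensity hg hf₀,
          lintegral_withDensity_eq_lintegral_mul _ (by fun_prop) (by fun_prop)]
        exact lintegral_congr fun x => mul_comm _ _
    _ ≤ 1 + ∫⁻ x, d x ^ 2 / observationDensity g μ f₀ x :=
        lintegral_sq_div_mul_le (by fun_prop) (by fun_prop)
          (lintegral_observationDensity hg hf₀ hμ) (lintegral_observationDensity hg hf hμ)
          (observationDensity_le_add hgm hf₀m hf₀m hμ.1 hε
            fun θ => sub_le_iff_le_add'.1 (abs_sub_le_iff.1 (h θ)).1)
          (observationDensity_le_add hgm hfm hf₀m hμ.1 hε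
            fun θ => sub_le_iff_le_add'.1 (abs_sub_le_iff.1 (h θ)).2)
    _ = 1 + ENNReal.ofReal ((μ * ε) ^ 2) *
          ∫⁻ x, convDensity g f₀ x ^ 2 / observationDensity g μ f₀ x := by
        rw [← lintegral_const_mul _ (by fun_prop), ENNReal.ofReal_pow (mul_nonneg hμ.1 hε)]
        simp only [d, mul_pow, mul_div_assoc]
    _ ≤ 1 + ENNReal.ofReal ((μ * ε) ^ 2) * (1 + chiIntegral g f₀) := by
        gcongr
        exact lintegral_convDensity_sq_div_le hg hf₀ hμ

end ObservationLaw

section DensityClass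

/-- The densities a pair in `IsAdmissiblePair g φ C_I` is made of, with the separation of the two
functionals left out. -/
def densityClass (g φ : ℝ → ℝ) (C_I : ℝ) : Set (ℝ → ℝ) :=
  {f | IsPDF f ∧ Integrable (fun θ => φ θ * f θ) ∧ chiIntegral g f ≤ ENNReal.ofReal C_I}

variable {g φ f₁ f₂ : ℝ → ℝ} {C_I a b ε : ℝ}

lemma functional_smul_add_smul (h₁ : Integrable fun θ => φ θ * f₁ θ)
    (h₂ : Integrable fun θ => φ θ * f₂ θ) (a b : ℝ) :
    functional φ (a • f₁ + b • f₂) = a * functional φ f₁ + b * functional φ f₂ := by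
  simp only [functional, Pi.add_apply, Pi.smul_apply, smul_eq_mul, mul_add, mul_left_comm (φ _)]
  rw [integral_add (h₁.const_mul a) (h₂.const_mul b), integral_const_mul, integral_const_mul]

lemma isAdmissiblePair_iff :
    IsAdmissiblePair g φ C_I f₁ f₂ ↔ f₁ ∈ densityClass g φ C_I ∧ f₂ ∈ densityClass g φ C_I ∧
      functional φ f₁ ≠ functional φ f₂ := by
  have hsub (h₁ : Integrable fun θ => φ θ * f₁ θ) (h₂ : Integrable fun θ => φ θ * f₂ θ) :
      ∫ θ, φ θ * (f₁ θ - f₂ θ) ≠ 0 ↔ functional φ f₁ ≠ functional φ f₂ := by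
    simp only [mul_sub, functional]
    rw [integral_sub h₁ h₂, sub_ne_zero]
  constructor
  · rintro ⟨pdf₁, pdf₂, int₁, int₂, chi₁, chi₂, hsep⟩
    exact ⟨⟨pdf₁, int₁, chi₁⟩, ⟨pdf₂, int₂, chi₂⟩, (hsub int₁ int₂).1 hsep⟩
  · rintro ⟨⟨pdf₁, int₁, chi₁⟩, ⟨pdf₂, int₂, chi₂⟩, hne⟩
    exact ⟨pdf₁, pdf₂, int₁, int₂, chi₁, chi₂, (hsub int₁ int₂).2 hne⟩

lemma ofReal_mul_add_mul {x y : ℝ} (ha : 0 ≤ a) (hb : 0 ≤ b) (hx : 0 ≤ x) (hy : 0 ≤ y) :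
    ENNReal.ofReal (a * x + b * y) =
      ENNReal.ofReal a * ENNReal.ofReal x + ENNReal.ofReal b * ENNReal.ofReal y := by
  rw [ENNReal.ofReal_add (by positivity) (by positivity), ENNReal.ofReal_mul ha,
    ENNReal.ofReal_mul hb]

lemma convex_setOf_isPDF : Convex ℝ {f : ℝ → ℝ | IsPDF f} := by
  intro f₁ h₁ f₂ h₂ a b ha hb hab
  have hm₁ := h₁.measurable
  have hm₂ := h₂.measurable
  refine ⟨by fun_prop,
    fun x => add_nonneg (mul_nonneg ha (h₁.nonneg x)) (mul_nonneg hb (h₂.nonneg x)), ?_⟩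
  simp only [Pi.add_apply, Pi.smul_apply, smul_eq_mul,
    ofReal_mul_add_mul ha hb (h₁.nonneg _) (h₂.nonneg _)]
  rw [lintegral_add_left (by fun_prop), lintegral_const_mul _ (by fun_prop),
    lintegral_const_mul _ (by fun_prop), h₁.lintegral_eq_one, h₂.lintegral_eq_one, mul_one,
    mul_one, ofReal_add_ofReal_eq_one ha hb hab]

lemma convDensity_smul_add_smul (hg : Measurable g) (h₁ : IsPDF f₁) (h₂ : IsPDF f₂)
    (ha : 0 ≤ a) (hb : 0 ≤ b) (x : ℝ) :
    convDensity g (a • f₁ + b • f₂) x =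
      ENNReal.ofReal a * convDensity g f₁ x + ENNReal.ofReal b * convDensity g f₂ x := by
  have hm₁ := h₁.measurable
  have hm₂ := h₂.measurable
  unfold convDensity
  rw [← lintegral_const_mul _ (by fun_prop), ← lintegral_const_mul _ (by fun_prop),
    ← lintegral_add_left (by fun_prop)]
  refine lintegral_congr fun θ => ?_
  simp only [Pi.add_apply, Pi.smul_apply, smul_eq_mul,
    ofReal_mul_add_mul ha hb (h₁.nonneg _) (h₂.nonneg _)]
  ring

lemma sq_convexCombination_le {w₁ w₂ : ℝ≥0∞} (hw : w₁ + w₂ = 1) (x y : ℝ≥0∞) :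
    (w₁ * x + w₂ * y) ^ 2 ≤ w₁ * x ^ 2 + w₂ * y ^ 2 := by
  simpa only [ENNReal.rpow_two] using
    ENNReal.rpow_arith_mean_le_arith_mean2_rpow w₁ w₂ x y hw one_le_two

lemma chiIntegral_smul_add_smul_le (hg : Measurable g) (h₁ : IsPDF f₁) (h₂ : IsPDF f₂)
    (ha : 0 ≤ a) (hb : 0 ≤ b) (hab : a + b = 1) :
    chiIntegral g (a • f₁ + b • f₂) ≤
      ENNReal.ofReal a * chiIntegral g f₁ + ENNReal.ofReal b * chiIntegral g f₂ := by
  have hm₁ := h₁.measurable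
  have hm₂ := h₂.measurable
  have hw := ofReal_add_ofReal_eq_one ha hb hab
  calc chiIntegral g (a • f₁ + b • f₂)
      = ∫⁻ x, (ENNReal.ofReal (g x))⁻¹ * (ENNReal.ofReal a * convDensity g f₁ x +
          ENNReal.ofReal b * convDensity g f₂ x) ^ 2 := by
        simp only [← convDensity_smul_add_smul hg h₁ h₂ ha hb]
        rfl
    _ ≤ ∫⁻ x, (ENNReal.ofReal a * ((ENNReal.ofReal (g x))⁻¹ * convDensity g f₁ x ^ 2) +
          ENNReal.ofReal b * ((ENNReal.ofReal (g x))⁻¹ * convDensity g f₂ x ^ 2)) := by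
        refine lintegral_mono fun x => ?_
        calc _ ≤ (ENNReal.ofReal (g x))⁻¹ * (ENNReal.ofReal a * convDensity g f₁ x ^ 2 +
              ENNReal.ofReal b * convDensity g f₂ x ^ 2) := by
              gcongr; exact sq_convexCombination_le hw _ _
          _ = _ := by ring
    _ = ENNReal.ofReal a * chiIntegral g f₁ + ENNReal.ofReal b * chiIntegral g f₂ := by
        rw [lintegral_add_left (by fun_prop), lintegral_const_mul _ (by fun_prop),
          lintegral_const_mul _ (by fun_prop)]
        rfl

lemma convex_densityClass (hg : Measurable g) : Convex ℝ (densityClass g φ C_I) := by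
  rintro f₁ ⟨pdf₁, int₁, chi₁⟩ f₂ ⟨pdf₂, int₂, chi₂⟩ a b ha hb hab
  refine ⟨convex_setOf_isPDF pdf₁ pdf₂ ha hb hab, ?_, ?_⟩
  · refine ((int₁.const_mul a).add (int₂.const_mul b)).congr (.of_forall fun θ => ?_)
    simp only [Pi.add_apply, Pi.smul_apply, smul_eq_mul]
    ring
  · calc chiIntegral g (a • f₁ + b • f₂)
        ≤ ENNReal.ofReal a * chiIntegral g f₁ + ENNReal.ofReal b * chiIntegral g f₂ :=
          chiIntegral_smul_add_smul_le hg pdf₁ pdf₂ ha hb hab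
      _ ≤ ENNReal.ofReal a * ENNReal.ofReal C_I + ENNReal.ofReal b * ENNReal.ofReal C_I := by
          gcongr
      _ = ENNReal.ofReal C_I := by
          rw [← add_mul, ofReal_add_ofReal_eq_one ha hb hab, one_mul]

/-- The midpoint of `f₁` and `f₂`, moved towards `f₂` by `ε` times half the distance. The point of
starting at the midpoint is that `|f₂ - f₁| / 2` is dominated by it. -/
noncomputable def tiltedMidpoint (f₁ f₂ : ℝ → ℝ) (ε : ℝ) : ℝ → ℝ :=
  ((1 - ε) / 2) • f₁ + ((1 + ε) / 2) • f₂

lemma tiltedMidpoint_mem_densityClass (hg : Measurable g) (h₁ : f₁ ∈ densityClass g φ C_I)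
    (h₂ : f₂ ∈ densityClass g φ C_I) (hε : |ε| ≤ 1) :
    tiltedMidpoint f₁ f₂ ε ∈ densityClass g φ C_I := by
  obtain ⟨hε₁, hε₂⟩ := abs_le.1 hε
  exact convex_densityClass hg h₁ h₂ (by linarith) (by linarith) (by ring)

lemma abs_tiltedMidpoint_sub_le {θ : ℝ} (h₁ : 0 ≤ f₁ θ) (h₂ : 0 ≤ f₂ θ) (hε : 0 ≤ ε) :
    |tiltedMidpoint f₁ f₂ ε θ - tiltedMidpoint f₁ f₂ 0 θ| ≤ ε * tiltedMidpoint f₁ f₂ 0 θ := by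
  simp only [tiltedMidpoint, Pi.add_apply, Pi.smul_apply, smul_eq_mul]
  rw [abs_le]
  constructor <;> nlinarith [mul_nonneg hε h₁, mul_nonneg hε h₂]

lemma functional_tiltedMidpoint_sub (h₁ : Integrable fun θ => φ θ * f₁ θ)
    (h₂ : Integrable fun θ => φ θ * f₂ θ) (ε : ℝ) :
    functional φ (tiltedMidpoint f₁ f₂ ε) - functional φ (tiltedMidpoint f₁ f₂ 0) =
      ε * ((functional φ f₂ - functional φ f₁) / 2) := by
  simp only [tiltedMidpoint, functional_smul_add_smul h₁ h₂]
  ring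

end DensityClass

section MinimaxBound

variable {g φ f₀ f f₁ f₂ : ℝ → ℝ} {μ ε C_I : ℝ} {n : ℕ}

lemma edist_sq_eq_ofReal (x y : ℝ) : edist x y ^ 2 = ENNReal.ofReal ((x - y) ^ 2) := by
  rw [edist_dist, Real.dist_eq, ← ENNReal.ofReal_pow (abs_nonneg _), sq_abs]

lemma one_add_pow_le_ofReal_exp {c x : ℝ} (hx : 0 ≤ x) (hc : n * x ≤ c) :
    (1 + ENNReal.ofReal x) ^ n ≤ ENNReal.ofReal (Real.exp c) := by
  rw [← ENNReal.ofReal_one, ← ENNReal.ofReal_add zero_le_one hx,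
    ← ENNReal.ofReal_pow (by positivity)]
  refine ENNReal.ofReal_le_ofReal ?_
  calc (1 + x) ^ n ≤ Real.exp x ^ n := by
        gcongr; rw [add_comm]; exact Real.add_one_le_exp x
    _ = Real.exp (n * x) := (Real.exp_nat_mul x n).symm
    _ ≤ Real.exp c := Real.exp_le_exp.2 hc

lemma lintegral_likelihoodRatio_sq_pow_le (hg : IsPDF g) (hf₀ : IsPDF f₀) (hf : IsPDF f)
    (hμ : μ ∈ Icc 0 1) (hε : 0 ≤ ε) (h : ∀ θ, |f θ - f₀ θ| ≤ ε * f₀ θ) (hC : 0 ≤ C_I)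
    (hchi : chiIntegral g f₀ ≤ ENNReal.ofReal C_I) (hn : n * (μ * ε) ^ 2 ≤ 1) :
    (∫⁻ x, likelihoodRatio g μ f₀ f x ^ 2 ∂(observationLaw g μ f₀)) ^ n ≤
      ENNReal.ofReal (Real.exp (1 + C_I)) :=
  calc _ ≤ (1 + ENNReal.ofReal ((μ * ε) ^ 2 * (1 + C_I))) ^ n := by
        gcongr
        refine (lintegral_likelihoodRatio_sq_le hg hf₀ hf hμ hε h).trans ?_
        rw [ENNReal.ofReal_mul (sq_nonneg _), ENNReal.ofReal_add zero_le_one hC,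
          ENNReal.ofReal_one]
        gcongr
    _ ≤ ENNReal.ofReal (Real.exp (1 + C_I)) := by
        refine one_add_pow_le_ofReal_exp (by positivity) ?_
        rw [← mul_assoc]
        exact mul_le_of_le_one_left (by positivity) hn

lemma sq_functional_sub_le_max_risk (hg : IsPDF g) (hf₀ : IsPDF f₀) (hf : IsPDF f)
    (hμ : μ ∈ Icc 0 1) (hε : 0 ≤ ε) (h : ∀ θ, |f θ - f₀ θ| ≤ ε * f₀ θ) (hC : 0 ≤ C_I)
    (hchi : chiIntegral g f₀ ≤ ENNReal.ofReal C_I) (hn : n * (μ * ε) ^ 2 ≤ 1)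
    {T : (Fin n → ℝ) → ℝ} (hT : Measurable T) :
    ENNReal.ofReal ((functional φ f - functional φ f₀) ^ 2) ≤
      ENNReal.ofReal (2 * (Real.exp (1 + C_I) + 1)) *
        max (risk g φ μ T f₀) (risk g φ μ T f) := by
  have := isProbabilityMeasure_observationLaw hg hf₀ hμ
  have hlaw := observationLaw_eq_withDensity_likelihoodRatio hg hf₀ hf hμ hε h
  have : IsProbabilityMeasure
      ((observationLaw g μ f₀).withDensity (likelihoodRatio g μ f₀ f)) :=
    hlaw ▸ isProbabilityMeasure_observationLaw hg hf hμ
  have hleCam := sq_edist_le_max_lintegral_pi (observationLaw g μ f₀)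
    (measurable_likelihoodRatio hg.measurable hf₀.measurable hf.measurable μ) hT
    (functional φ f₀) (functional φ f)
  rw [← hlaw, Fintype.card_fin, edist_comm] at hleCam
  simp only [edist_sq_eq_ofReal] at hleCam
  rw [ENNReal.ofReal_mul zero_le_two, ENNReal.ofReal_add (Real.exp_pos _).le zero_le_one,
    ENNReal.ofReal_one, ENNReal.ofReal_ofNat]
  refine hleCam.trans (mul_le_mul_left ?_ _)
  gcongr
  exact lintegral_likelihoodRatio_sq_pow_le hg hf₀ hf hμ hε h hC hchi hn

lemma ofReal_le_minimaxRisk_of_sq_le (hg : IsPDF g) (hpair : IsAdmissiblePair g φ C_I f₁ f₂)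
    (hC : 0 ≤ C_I) (hμ : μ ∈ Icc 0 1) (hε : ε ∈ Ioc 0 1) (hn : n * (μ * ε) ^ 2 ≤ 1) :
    ENNReal.ofReal ((functional φ f₂ - functional φ f₁) ^ 2 / (8 * (Real.exp (1 + C_I) + 1)) *
      ε ^ 2) ≤ minimaxRisk g φ C_I n μ := by
  obtain ⟨hf₁, hf₂, hne⟩ := isAdmissiblePair_iff.1 hpair
  set f₀ := tiltedMidpoint f₁ f₂ 0
  set f := tiltedMidpoint f₁ f₂ ε
  have hf₀mem : f₀ ∈ densityClass g φ C_I :=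
    tiltedMidpoint_mem_densityClass hg.measurable hf₁ hf₂ (by simp)
  have hfmem : f ∈ densityClass g φ C_I :=
    tiltedMidpoint_mem_densityClass hg.measurable hf₁ hf₂ (by rw [abs_of_pos hε.1]; exact hε.2)
  have hdiff : functional φ f - functional φ f₀ =
      ε * ((functional φ f₂ - functional φ f₁) / 2) :=
    functional_tiltedMidpoint_sub hf₁.2.1 hf₂.2.1 ε
  have hadm : IsAdmissiblePair g φ C_I f₀ f := by
    refine isAdmissiblePair_iff.2 ⟨hf₀mem, hfmem, (sub_ne_zero.1 ?_).symm⟩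
    rw [hdiff]
    exact mul_ne_zero hε.1.ne' (div_ne_zero (sub_ne_zero.2 hne.symm) two_ne_zero)
  refine le_iInf₂ fun T hT => ?_
  refine le_trans ?_ (le_iSup_of_le f₀ (le_iSup_of_le f (le_iSup_of_le hadm le_rfl)))
  have hlower := sq_functional_sub_le_max_risk (φ := φ) hg hf₀mem.1 hfmem.1 hμ hε.1.le
    (fun θ => abs_tiltedMidpoint_sub_le (hf₁.1.nonneg θ) (hf₂.1.nonneg θ) hε.1.le) hC hf₀mem.2.2
    hn hT
  have hK : 0 < 2 * (Real.exp (1 + C_I) + 1) := by positivity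
  calc ENNReal.ofReal ((functional φ f₂ - functional φ f₁) ^ 2 /
        (8 * (Real.exp (1 + C_I) + 1)) * ε ^ 2)
      = ENNReal.ofReal ((functional φ f - functional φ f₀) ^ 2) /
          ENNReal.ofReal (2 * (Real.exp (1 + C_I) + 1)) := by
        rw [← ENNReal.ofReal_div_of_pos hK, hdiff]
        congr 1
        field_simp
        ring
    _ ≤ max (risk g φ μ T f₀) (risk g φ μ T f) := ENNReal.div_le_of_le_mul' hlower

theorem IsAdmissiblePair.exists_le_minimaxRisk (hg : IsPDF g)
    (hpair : IsAdmissiblePair g φ C_I f₁ f₂) (hC : 0 ≤ C_I) :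
    ∃ C : ℝ, 0 < C ∧ ∀ n : ℕ, 0 < n → ∀ μ : ℝ, 0 < μ → μ ≤ 1 →
      ENNReal.ofReal (C * min 1 ((n : ℝ) * μ ^ 2)⁻¹) ≤ minimaxRisk g φ C_I n μ := by
  have hsep : functional φ f₂ - functional φ f₁ ≠ 0 :=
    sub_ne_zero.2 (isAdmissiblePair_iff.1 hpair).2.2.symm
  refine ⟨(functional φ f₂ - functional φ f₁) ^ 2 / (8 * (Real.exp (1 + C_I) + 1)), by positivity,
    fun n hn μ hμ0 hμ1 => ?_⟩
  set r := min 1 ((n : ℝ) * μ ^ 2)⁻¹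
  have hr : 0 < r := lt_min one_pos (by positivity)
  have hrate : n * (μ * √r) ^ 2 ≤ 1 := by
    rw [mul_pow, Real.sq_sqrt hr.le, ← mul_assoc]
    exact mul_le_of_le_inv_mul₀ (by positivity) (by positivity) (by simp [r])
  have hbound := ofReal_le_minimaxRisk_of_sq_le hg hpair hC ⟨hμ0.le, hμ1⟩
    ⟨Real.sqrt_pos.2 hr, Real.sqrt_le_one.2 (min_le_left _ _)⟩ hrate
  rwa [Real.sq_sqrt hr.le] at hbound

end MinimaxBound

section ShiftDivergence

/-- The divergence of chi-squared type, `∫ g(x - θ)² / g(x) dx`, between the error density `g` and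
its translate by `θ`. -/
noncomputable def shiftChi (g : ℝ → ℝ) (θ : ℝ) : ℝ≥0∞ :=
  ∫⁻ x, (ENNReal.ofReal (g x))⁻¹ * ENNReal.ofReal (g (x - θ)) ^ 2

variable {g f : ℝ → ℝ}

lemma convDensity_sq_le (hg : Measurable g) (hf : IsPDF f) (x : ℝ) :
    convDensity g f x ^ 2 ≤ ∫⁻ θ, ENNReal.ofReal (g (x - θ)) ^ 2 * ENNReal.ofReal (f θ) := by
  have hfm := hf.measurable
  have := hf.isProbabilityMeasure
  have hjensen := sq_lintegral_le (volume.withDensity fun θ => ENNReal.ofReal (f θ))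
    (u := fun θ => ENNReal.ofReal (g (x - θ))) (by fun_prop)
  rw [lintegral_withDensity_eq_lintegral_mul _ (by fun_prop) (by fun_prop),
    lintegral_withDensity_eq_lintegral_mul _ (by fun_prop) (by fun_prop)] at hjensen
  simpa only [Pi.mul_apply, mul_comm (ENNReal.ofReal (f _)), convDensity] using hjensen

lemma chiIntegral_le_lintegral_shiftChi (hg : Measurable g) (hf : IsPDF f) :
    chiIntegral g f ≤ ∫⁻ θ, shiftChi g θ * ENNReal.ofReal (f θ) := by
  have hfm := hf.measurable
  calc chiIntegral g f
      ≤ ∫⁻ x, ∫⁻ θ, (ENNReal.ofReal (g x))⁻¹ * ENNReal.ofReal (g (x - θ)) ^ 2 *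
          ENNReal.ofReal (f θ) := by
        refine lintegral_mono fun x => (mul_le_mul_right (convDensity_sq_le hg hf x) _).trans ?_
        rw [← lintegral_const_mul _ (by fun_prop)]
        simp only [mul_assoc, le_refl]
    _ = ∫⁻ θ, ∫⁻ x, (ENNReal.ofReal (g x))⁻¹ * ENNReal.ofReal (g (x - θ)) ^ 2 *
          ENNReal.ofReal (f θ) := by
        refine lintegral_lintegral_swap (Measurable.aemeasurable ?_)
        unfold Function.uncurry; fun_prop
    _ = ∫⁻ θ, shiftChi g θ * ENNReal.ofReal (f θ) :=
        lintegral_congr fun θ => lintegral_mul_const _ (by fun_prop)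

end ShiftDivergence

section UniformDensity

/-- The density of the uniform distribution on `K`; a genuine density only if `K` has positive
finite measure. -/
noncomputable def uniformDensity (K : Set ℝ) : ℝ → ℝ := K.indicator fun _ => (volume.real K)⁻¹

variable {g φ : ℝ → ℝ} {K : Set ℝ}

lemma lintegral_mul_uniformDensity (hK : MeasurableSet K) {u : ℝ → ℝ≥0∞} :
    ∫⁻ θ, u θ * ENNReal.ofReal (uniformDensity K θ) =
      (∫⁻ θ in K, u θ) * ENNReal.ofReal (volume.real K)⁻¹ := by
  have hind : (fun θ => u θ * ENNReal.ofReal (uniformDensity K θ)) =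
      K.indicator fun θ => u θ * ENNReal.ofReal (volume.real K)⁻¹ := by
    funext θ
    by_cases hθ : θ ∈ K <;> simp [uniformDensity, hθ]
  rw [hind, lintegral_indicator hK, lintegral_mul_const' _ _ ENNReal.ofReal_ne_top]

lemma isPDF_uniformDensity (hK : IsCompact K) (h0 : volume K ≠ 0) : IsPDF (uniformDensity K) where
  measurable := measurable_const.indicator hK.measurableSet
  nonneg := indicator_nonneg fun _ _ => inv_nonneg.2 measureReal_nonneg
  lintegral_eq_one := by
    have hpos : 0 < volume.real K := ENNReal.toReal_pos h0 hK.measure_ne_top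
    simpa [ENNReal.ofReal_inv_of_pos hpos, ofReal_measureReal hK.measure_ne_top,
      ENNReal.mul_inv_cancel h0 hK.measure_ne_top] using
      lintegral_mul_uniformDensity hK.measurableSet (u := 1)

lemma mul_uniformDensity (φ : ℝ → ℝ) (K : Set ℝ) :
    (fun θ => φ θ * uniformDensity K θ) = K.indicator fun θ => φ θ * (volume.real K)⁻¹ := by
  funext θ
  by_cases hθ : θ ∈ K <;> simp [uniformDensity, hθ]

lemma integrable_mul_uniformDensity (hφ : LocallyIntegrable φ) (hK : IsCompact K) :
    Integrable fun θ => φ θ * uniformDensity K θ := by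
  rw [mul_uniformDensity, integrable_indicator_iff hK.measurableSet]
  exact (hφ.integrableOn_isCompact hK).mul_const _

lemma functional_uniformDensity (φ : ℝ → ℝ) (hK : MeasurableSet K) :
    functional φ (uniformDensity K) = ⨍ x in K, φ x := by
  rw [functional, mul_uniformDensity, integral_indicator hK, integral_mul_const, setAverage_eq,
    smul_eq_mul, mul_comm]

lemma chiIntegral_uniformDensity_ne_top (hg : Measurable g) (hK : IsCompact K)
    (h0 : volume K ≠ 0) (hχ : ∫⁻ θ in K, shiftChi g θ ≠ ∞) :
    chiIntegral g (uniformDensity K) ≠ ∞ := by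
  refine ne_top_of_le_ne_top ?_ (chiIntegral_le_lintegral_shiftChi hg (isPDF_uniformDensity hK h0))
  rw [lintegral_mul_uniformDensity hK.measurableSet]
  exact ENNReal.mul_ne_top hχ ENNReal.ofReal_ne_top

lemma uniformDensity_mem_densityClass (hg : Measurable g) (hφ : LocallyIntegrable φ)
    (hK : IsCompact K) (h0 : volume K ≠ 0) (hχ : ∫⁻ θ in K, shiftChi g θ ≠ ∞) {C_I : ℝ}
    (hC : (chiIntegral g (uniformDensity K)).toReal ≤ C_I) :
    uniformDensity K ∈ densityClass g φ C_I :=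
  ⟨isPDF_uniformDensity hK h0, integrable_mul_uniformDensity hφ hK,
    ENNReal.le_ofReal_iff_toReal_le (chiIntegral_uniformDensity_ne_top hg hK h0 hχ)
      (ENNReal.toReal_nonneg.trans hC) |>.2 hC⟩

lemma exists_isCompact_setAverage_ne {X E : Type*} [TopologicalSpace X] [MeasurableSpace X]
    [BorelSpace X] [SigmaCompactSpace X] [R1Space X] [NormedAddCommGroup E] [NormedSpace ℝ E]
    [CompleteSpace E] {ν : Measure X} [IsLocallyFiniteMeasure ν] {ψ : X → E}
    (hψ : LocallyIntegrable ψ ν) {c : E} (hc : ¬ ∀ᵐ x ∂ν, ψ x = c) :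
    ∃ K : Set X, IsCompact K ∧ ν K ≠ 0 ∧ ⨍ x in K, ψ x ∂ν ≠ c := by
  by_contra! hall
  have hint (K : Set X) (hK : IsCompact K) : ∫ x in K, (ψ x - c) ∂ν = 0 := by
    rcases eq_or_ne (ν K) 0 with h0 | h0
    · exact setIntegral_measure_zero _ h0
    · rw [integral_sub (hψ.integrableOn_isCompact hK) (integrableOn_const hK.measure_ne_top),
        setIntegral_const, ← measure_smul_setAverage ψ hK.measure_ne_top, hall K hK h0, sub_self]
  have hzero := ae_eq_zero_of_forall_setIntegral_isCompact_eq_zero'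
    (hψ.sub (locallyIntegrable_const c)) hint
  exact hc (hzero.mono fun x hx => sub_eq_zero.1 hx)

lemma exists_isAdmissiblePair (hg : Measurable g)
    (hχ : ∀ K, IsCompact K → ∫⁻ θ in K, shiftChi g θ ≠ ∞) (hφ : LocallyIntegrable φ)
    (hφ_nonconst : ¬ ∃ c : ℝ, ∀ᵐ x : ℝ, φ x = c) :
    ∃ C_I : ℝ, 0 < C_I ∧ ∃ f₁ f₂, IsAdmissiblePair g φ C_I f₁ f₂ := by
  set I : Set ℝ := Icc 0 1
  have hI : IsCompact I := isCompact_Icc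
  have hI0 : volume I ≠ 0 := by simp [I]
  obtain ⟨K, hK, hK0, hne⟩ :=
    exists_isCompact_setAverage_ne hφ (not_exists.1 hφ_nonconst (⨍ x in I, φ x))
  set χI := (chiIntegral g (uniformDensity I)).toReal
  set χK := (chiIntegral g (uniformDensity K)).toReal
  have hχI : 0 ≤ χI := ENNReal.toReal_nonneg
  have hχK : 0 ≤ χK := ENNReal.toReal_nonneg
  refine ⟨χI + χK + 1, by positivity, uniformDensity I, uniformDensity K,
    isAdmissiblePair_iff.2 ⟨?_, ?_, ?_⟩⟩
  · exact uniformDensity_mem_densityClass hg hφ hI hI0 (hχ I hI) (by linarith)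
  · exact uniformDensity_mem_densityClass hg hφ hK hK0 (hχ K hK) (by linarith)
  · rw [functional_uniformDensity φ hI.measurableSet, functional_uniformDensity φ hK.measurableSet]
    exact hne.symm

end UniformDensity

section Gaussian

variable {v : ℝ≥0}

lemma isPDF_gaussianPDFReal (m : ℝ) (hv : v ≠ 0) : IsPDF (gaussianPDFReal m v) :=
  ⟨measurable_gaussianPDFReal m v, gaussianPDFReal_nonneg m v,
    lintegral_gaussianPDFReal_eq_one m hv⟩

lemma continuous_gaussianPDFReal (m : ℝ) (v : ℝ≥0) : Continuous (gaussianPDFReal m v) := by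
  rw [gaussianPDFReal_def]; fun_prop

lemma inv_mul_gaussianPDFReal_sub_sq (m : ℝ) (hv : v ≠ 0) (x θ : ℝ) :
    (gaussianPDFReal m v x)⁻¹ * gaussianPDFReal m v (x - θ) ^ 2 =
      Real.exp (θ ^ 2 / v) * gaussianPDFReal (m + 2 * θ) v x := by
  have hexp : Real.exp ((2 : ℕ) * (-(x - θ - m) ^ 2 / (2 * v))) =
      Real.exp (-(x - m) ^ 2 / (2 * v)) *
        (Real.exp (θ ^ 2 / v) * Real.exp (-(x - (m + 2 * θ)) ^ 2 / (2 * v))) := by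
    rw [← Real.exp_add, ← Real.exp_add]
    congr 1
    field_simp
    push_cast
    ring
  rw [inv_mul_eq_iff_eq_mul₀ (gaussianPDFReal_pos _ _ _ hv).ne']
  simp only [gaussianPDFReal]
  rw [mul_pow, ← Real.exp_nat_mul, hexp]
  ring

lemma shiftChi_gaussianPDFReal (m : ℝ) (hv : v ≠ 0) (θ : ℝ) :
    shiftChi (gaussianPDFReal m v) θ = ENNReal.ofReal (Real.exp (θ ^ 2 / v)) := by
  have hpos := fun x => gaussianPDFReal_pos m v x hv
  calc shiftChi (gaussianPDFReal m v) θ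
      = ∫⁻ x, ENNReal.ofReal (Real.exp (θ ^ 2 / v)) *
          ENNReal.ofReal (gaussianPDFReal (m + 2 * θ) v x) := by
        refine lintegral_congr fun x => ?_
        rw [← ENNReal.ofReal_inv_of_pos (hpos x), ← ENNReal.ofReal_pow (hpos _).le,
          ← ENNReal.ofReal_mul (inv_nonneg.2 (hpos x).le), inv_mul_gaussianPDFReal_sub_sq m hv,
          ENNReal.ofReal_mul (Real.exp_pos _).le]
    _ = ENNReal.ofReal (Real.exp (θ ^ 2 / v)) := by
        rw [lintegral_const_mul _ (by fun_prop), lintegral_gaussianPDFReal_eq_one _ hv, mul_one]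

lemma setLIntegral_shiftChi_gaussianPDFReal_ne_top (m : ℝ) (hv : v ≠ 0) {K : Set ℝ}
    (hK : IsCompact K) : ∫⁻ θ in K, shiftChi (gaussianPDFReal m v) θ ≠ ∞ := by
  simp only [shiftChi_gaussianPDFReal m hv]
  have hcont : Continuous fun θ : ℝ => Real.exp (θ ^ 2 / v) := by fun_prop
  exact (hcont.continuousOn.integrableOn_compact hK).lintegral_lt_top.ne

lemma locallyIntegrable_of_mul_continuous {X 𝕜 : Type*} [TopologicalSpace X] [MeasurableSpace X]
    [OpensMeasurableSpace X] [LocallyCompactSpace X] [T2Space X] [NormedField 𝕜]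
    [SecondCountableTopologyEither X 𝕜] {ν : Measure X} {φ g : X → 𝕜} (hg : Continuous g)
    (hg0 : ∀ x, g x ≠ 0) (h : LocallyIntegrable (fun x => φ x * g x) ν) :
    LocallyIntegrable φ ν := by
  simpa only [Pi.inv_apply, mul_inv_cancel_right₀ (hg0 _)] using h.mul_continuous (hg.inv₀ hg0)

end Gaussian

end SparseDeconv

open SparseDeconv

theorem corollary3_general {g φ : ℝ → ℝ} (hg : IsPDF g)
    (hχ : ∀ K, IsCompact K → ∫⁻ θ in K, shiftChi g θ ≠ ∞) (hφ : LocallyIntegrable φ)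
    (hφ_nonconst : ¬ ∃ c : ℝ, ∀ᵐ x : ℝ, φ x = c) :
    ∃ C_I : ℝ, 0 < C_I ∧ (∃ f₁ f₂ : ℝ → ℝ, IsAdmissiblePair g φ C_I f₁ f₂) ∧
      ∃ C : ℝ, 0 < C ∧ ∀ n : ℕ, 0 < n → ∀ μ : ℝ, 0 < μ → μ ≤ 1 →
        ENNReal.ofReal (C * min 1 ((n : ℝ) * μ ^ 2)⁻¹) ≤ minimaxRisk g φ C_I n μ := by
  obtain ⟨C_I, hC_I, f₁, f₂, hpair⟩ := exists_isAdmissiblePair hg.measurable hχ hφ hφ_nonconst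
  exact ⟨C_I, hC_I, ⟨f₁, f₂, hpair⟩, hpair.exists_le_minimaxRisk hg hC_I.le⟩

theorem corollary3 (σ : ℝ≥0) (hσ : σ ≠ 0) (φ : ℝ → ℝ)
    (hφ : Integrable (fun x => φ x * gaussianPDFReal 0 (σ ^ 2) x))
    (hφ_nonconst : ¬ ∃ c : ℝ, ∀ᵐ x : ℝ, φ x = c) :
    ∃ C_I : ℝ, 0 < C_I ∧
      (∃ f₁ f₂ : ℝ → ℝ,
        SparseDeconv.IsAdmissiblePair (gaussianPDFReal 0 (σ ^ 2)) φ C_I f₁ f₂) ∧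
      ∃ C : ℝ, 0 < C ∧ ∀ n : ℕ, 0 < n → ∀ μ : ℝ, 0 < μ → μ ≤ 1 →
        ENNReal.ofReal (C * min 1 ((n : ℝ) * μ ^ 2)⁻¹) ≤
          SparseDeconv.minimaxRisk (gaussianPDFReal 0 (σ ^ 2)) φ C_I n μ := by
  have hv : σ ^ 2 ≠ 0 := pow_ne_zero 2 hσ
  exact corollary3_general (isPDF_gaussianPDFReal 0 hv)
    (fun _ => setLIntegral_shiftChi_gaussianPDFReal_ne_top 0 hv)
    (locallyIntegrable_of_mul_continuous (continuous_gaussianPDFReal 0 _)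
      (fun x => (gaussianPDFReal_pos 0 _ x hv).ne') hφ.locallyIntegrable) hφ_nonconst
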